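/- For each $\lambda>0$ let $N_1,N_2,\dots\sim\mathrm{Poisson}(\lambda)$ and $U_1,U_2,\dots\sim\mathrm{Uniform}(0,1)$ be random variables, all mutually independent, on a probability space $(\Omega_\lambda,\mathbb P_\lambda)$, and put $Z_i=N_i+U_i$. For each $n\ge 1$ let $\widehat{\mathrm{Median}}(Z_1,\dots,Z_n)$ be a sample median, i.e. any real number $m$ (chosen for each outcome) such that at least $n/2$ of the values $Z_1,\dots,Z_n$ are $\le m$ and at least $n/2$ of them are $\ge m$. Then $$\widehat{\mathrm{Median}}(Z_1,\dots,Z_n)-\tfrac13\ \stackrel{\mathbb P}{\longrightarrow}\ \lambda\qquad\text{as } n\to\infty \text{ and then } \lambda\to\infty,$$ in the following sense of an iterated limit. (i) For every fixed $\lambda>0$, $\widehat{\mathrm{Median}}(Z_1,\dots,Z_n)-\tfrac13$ converges in probability, as $n\to\infty$, to $\mathrm{Median}(Z_1)-\tfrac13$, where $\mathrm{Median}(Z_1)=\inf\{x\in\mathbb R:\mathbb P_\lambda(Z_1\le x)\ge \tfrac12\}$. (ii) For every $\varepsilon>0$ there is $\lambda_0>0$ such that for every $\lambda\ge\lambda_0$,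 $$\lim_{n\to\infty}\mathbb P_\lambda\Big(\big|\widehat{\mathrm{Median}}(Z_1,\dots,Z_n)-\tfrac13-\lambda\big|\ge\varepsilon\Big)=0 .$$ (Where the chosen sample median is not measurable, probabilities are understood as outer probabilities.) -/

import Mathlib

open MeasureTheory ProbabilityTheory Filter Topology
open scoped NNReal

/-- The median `inf {x : P(X ≤ x) ≥ 1/2}` of a real random variable `X`. -/
noncomputable def rvMedian {Ω : Type*} [MeasurableSpace Ω] (P : Measure Ω) (X : Ω → ℝ) : ℝ :=
  sInf {x : ℝ | 1 / 2 ≤ P.real {ω | X ω ≤ x}}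

/-- `m` is a sample median of `z 0, …, z (n - 1)`: at least half of the observations are `≤ m`
and at least half of them are `≥ m`. For odd `n` this says that `m` is the middle order statistic;
for even `n` it says that `m` lies between the two middle order statistics (both included), so
every usual convention (lower median, upper median, midpoint) is covered. -/
def IsSampleMedian {n : ℕ} (z : Fin n → ℝ) (m : ℝ) : Prop :=
  n ≤ 2 * Nat.card {i : Fin n // z i ≤ m} ∧ n ≤ 2 * Nat.card {i : Fin n // m ≤ z i}

/-- `N 0, N 1, …` are Poisson with mean `lam`, `U 0, U 1, …` are uniform on `(0, 1)`,
and all these random variables together are mutually independent. -/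
structure IsPoissonUniformSample {Ω : Type*} [MeasurableSpace Ω] (P : Measure Ω) (lam : ℝ≥0)
    (N : ℕ → Ω → ℕ) (U : ℕ → Ω → ℝ) : Prop where
  hasLaw_poisson : ∀ i, HasLaw (N i) (poissonMeasure lam) P
  isUniform : ∀ i, pdf.IsUniform (U i) (Set.Ioo (0 : ℝ) 1) P
  indep : iIndepFun (Sum.elim (fun i ω => (N i ω : ℝ)) U) P

/-- The jittered Poisson observations `Z i = N i + U i`. -/
def jittered {Ω : Type*} (N : ℕ → Ω → ℕ) (U : ℕ → Ω → ℝ) (i : ℕ) (ω : Ω) : ℝ :=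
  (N i ω : ℝ) + U i ω

/-! Write `p n` for `poissonMass n n` and `B s k` for `poissonBelow s k`. The distribution function
of `Z` at `k + t` is `B lam k + t * poissonMass lam k`, so by the law of large numbers it is enough
to know where this linear interpolation crosses `1 / 2`.

For integer mean the crossing comes from Ramanujan's estimate `1 / 2 - B n n ~ p n / 3`
(`eventually_abs_half_sub_poissonBelow_le`). Both sides tend to `0`, by the central limit theorem
and by Stirling, so their decrements can be compared (Stolz–Cesàro). Since the derivative of `B s (n
+ 1)` in `s` is `-poissonMass s n`, and `poissonMass (n + s) n ≈ p n * (1 - s ^ 2 / (2 * n))` on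
`[0, 1]`, the left side decreases by about `p n / (6 * n)`: integrate `s ^ 2 / (2 * n)`. The mass `p
n` decreases by about `p n / (2 * n)`: put `s = 1`. The quotient is `1 / 3`.

A first-order expansion in the mean then gives `1 / 2 + (n + t - s - 1 / 3 + o(1)) * p n` for real
mean `s` within `1` of `n` (`eventually_abs_interpolation_sub_le`). Hence the crossing is at `s + 1
/ 3 + o(1)`. -/

/-! ### Poisson masses as functions of the mean -/

/-- The mass `e⁻ˢ sᵏ / k!` that the Poisson law with mean `s` gives to `k`. -/
noncomputable def poissonMass (s : ℝ) (k : ℕ) : ℝ := Real.exp (-s) * s ^ k / k.factorial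

/-- The mass that the Poisson law with mean `s` gives to `{0, …, k - 1}`. -/
noncomputable def poissonBelow (s : ℝ) (k : ℕ) : ℝ := ∑ j ∈ Finset.range k, poissonMass s j

lemma poissonMass_pos {s : ℝ} (hs : 0 < s) (k : ℕ) : 0 < poissonMass s k := by
  unfold poissonMass; positivity

lemma poissonMass_succ (s : ℝ) (k : ℕ) :
    poissonMass s (k + 1) = s / (k + 1) * poissonMass s k := by
  unfold poissonMass
  rw [Nat.factorial_succ]
  push_cast
  field_simp
  ring

/-- An integer mean has two equal modes; thus `p (n + 1)` is the value at `s = 1` of `poissonMass (n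
+ s) n`. -/
lemma poissonMass_succ_self (n : ℕ) :
    poissonMass ((n : ℝ) + 1) (n + 1) = poissonMass ((n : ℝ) + 1) n := by
  rw [poissonMass_succ, div_self (by positivity), one_mul]

lemma poissonBelow_succ (s : ℝ) (k : ℕ) :
    poissonBelow s (k + 1) = poissonBelow s k + poissonMass s k :=
  Finset.sum_range_succ _ _

lemma hasDerivAt_poissonMass_succ (k : ℕ) (s : ℝ) :
    HasDerivAt (fun s => poissonMass s (k + 1)) (poissonMass s k - poissonMass s (k + 1)) s := by
  have h := (((hasDerivAt_id s).neg.exp).mul (hasDerivAt_pow (k + 1) s)).div_const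
    ((k + 1).factorial : ℝ)
  refine h.congr_deriv ?_
  simp only [poissonMass, id, Nat.factorial_succ, Pi.neg_apply]
  push_cast
  field_simp
  ring_nf

/-- The derivatives of the single masses telescope, leaving only the last one. -/
lemma hasDerivAt_poissonBelow (k : ℕ) (s : ℝ) :
    HasDerivAt (fun s => poissonBelow s (k + 1)) (-poissonMass s k) s := by
  induction k with
  | zero =>
    simpa [poissonBelow, poissonMass] using (hasDerivAt_id s).neg.exp
  | succ k ih =>
    simp_rw [poissonBelow_succ _ (k + 1)]
    exact (ih.add (hasDerivAt_poissonMass_succ k s)).congr_deriv (by ring)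

/-! ### Changes when the mean goes from `n` to `n + 1` -/

lemma sub_sq_div_two_le_log {u : ℝ} (hu : 0 ≤ u) : u - u ^ 2 / 2 ≤ Real.log (1 + u) := by
  refine le_trans ?_ (Real.le_log_one_add_of_nonneg hu)
  rw [le_div_iff₀ (by positivity)]
  nlinarith [pow_nonneg hu 3]

lemma log_le_cubic {u : ℝ} (hu : 0 ≤ u) : Real.log (1 + u) ≤ u - u ^ 2 / 2 + u ^ 3 / 3 := by
  have hd : ∀ x : ℝ, 0 ≤ x → HasDerivAt
      (fun u : ℝ => u - u ^ 2 / 2 + u ^ 3 / 3 - Real.log (1 + u)) (x ^ 3 / (1 + x)) x := by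
    intro x hx
    have h1 : HasDerivAt (fun u : ℝ => Real.log (1 + u)) (1 / (1 + x)) x :=
      ((hasDerivAt_id x).const_add 1).log (by simp; positivity)
    refine ((((hasDerivAt_id x).sub ((hasDerivAt_pow 2 x).div_const 2)).add
      ((hasDerivAt_pow 3 x).div_const 3)).sub h1).congr_deriv ?_
    have : 1 + x ≠ 0 := by positivity
    field_simp
    push_cast
    ring
  have hm : MonotoneOn (fun u : ℝ => u - u ^ 2 / 2 + u ^ 3 / 3 - Real.log (1 + u)) (Set.Ici 0) := by
    refine monotoneOn_of_deriv_nonneg (convex_Ici 0)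
      (fun x hx => (hd x hx).continuousAt.continuousWithinAt)
      (fun x hx => (hd x (interior_subset hx)).differentiableAt.differentiableWithinAt) ?_
    intro x hx
    have hx0 : (0 : ℝ) ≤ x := interior_subset hx
    rw [(hd x hx0).deriv]
    positivity
  have := hm (Set.self_mem_Ici) hu hu
  simp at this
  linarith

lemma poissonMass_add_eq {n : ℕ} (hn : 0 < n) {s : ℝ} (hs : 0 ≤ s) :
    poissonMass (n + s) n
      = poissonMass n n * Real.exp (n * Real.log (1 + s / n) - s) := by
  have hn' : (0 : ℝ) < n := by exact_mod_cast hn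
  have h : (n : ℝ) + s = n * (1 + s / n) := by field_simp
  rw [Real.exp_sub, Real.exp_nat_mul, Real.exp_log (by positivity)]
  have hp : ((n : ℝ) + s) ^ n = n ^ n * (1 + s / n) ^ n := by rw [h, mul_pow]
  unfold poissonMass
  rw [neg_add, Real.exp_add, Real.exp_neg s, hp]
  field_simp

lemma poissonMass_add_ge {n : ℕ} (hn : 0 < n) {s : ℝ} (hs : 0 ≤ s) :
    poissonMass n n * (1 - s ^ 2 / (2 * n)) ≤ poissonMass (n + s) n := by
  have hn' : (0 : ℝ) < n := by exact_mod_cast hn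
  rw [poissonMass_add_eq hn hs]
  have h := sub_sq_div_two_le_log (u := s / n) (by positivity)
  have h2 := mul_le_mul_of_nonneg_left h hn'.le
  have h3 : (n : ℝ) * (s / n - (s / n) ^ 2 / 2) = s - s ^ 2 / (2 * n) := by field_simp
  refine mul_le_mul_of_nonneg_left ?_ (poissonMass_pos hn' n).le
  refine le_trans ?_ (Real.add_one_le_exp _)
  linarith

lemma poissonMass_add_le {n : ℕ} (hn : 0 < n) {s : ℝ} (hs : 0 ≤ s) (hs1 : s ≤ 1) :
    poissonMass (n + s) n ≤ poissonMass n n * (1 - s ^ 2 / (2 * n) + 1 / n ^ 2) := by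
  have hn1 : (1 : ℝ) ≤ n := by exact_mod_cast hn
  have hn' : (0 : ℝ) < n := by linarith
  rw [poissonMass_add_eq hn hs]
  have hl := mul_le_mul_of_nonneg_left (sub_sq_div_two_le_log (u := s / n) (by positivity)) hn'.le
  have hu := mul_le_mul_of_nonneg_left (log_le_cubic (u := s / n) (by positivity)) hn'.le
  have hu0 := mul_le_mul_of_nonneg_left
    (Real.log_le_sub_one_of_pos (x := 1 + s / n) (by positivity)) hn'.le
  have h0 : (n : ℝ) * (1 + s / n - 1) = s := by field_simp; ring
  have h3 : (n : ℝ) * (s / n - (s / n) ^ 2 / 2) = s - s ^ 2 / (2 * n) := by field_simp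
  have h4 : (n : ℝ) * (s / n - (s / n) ^ 2 / 2 + (s / n) ^ 3 / 3)
      = s - s ^ 2 / (2 * n) + s ^ 3 / 3 * (1 / n ^ 2) := by field_simp
  set y := (n : ℝ) * Real.log (1 + s / n) - s with hy
  have hs2 : s ^ 2 ≤ 1 := by nlinarith
  have hs3 : s ^ 3 ≤ 1 := by nlinarith
  have ha : s ^ 2 / (2 * n) ≤ 1 / 2 * (1 / n) := by
    have : s ^ 2 / (2 * n) = s ^ 2 * (1 / 2 * (1 / n)) := by field_simp
    rw [this]
    exact mul_le_of_le_one_left (by positivity) hs2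
  have hi : (1 : ℝ) / n ≤ 1 := by rw [div_le_one hn']; exact hn1
  have hi2 : (1 : ℝ) / n ^ 2 = (1 / n) ^ 2 := by field_simp
  have hab : |y| ≤ 1 / 2 * (1 / n) := by rw [abs_le]; constructor <;> linarith [show 0 ≤ 1 / 2 * (1 / (n:ℝ)) by positivity]
  -- From `exp y ≤ 1 + y + y ^ 2`: the cubic term of the logarithm costs `1 / 3` and `y ^ 2` costs
  -- `1 / 4` of `1 / n ^ 2`, together less than `1`.
  have he := (abs_le.1 (Real.abs_exp_sub_one_sub_id_le (x := y) (by linarith))).2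
  have hy2 : y ^ 2 ≤ (1 / 2 * (1 / n)) ^ 2 := by
    rw [← sq_abs]; gcongr
  refine mul_le_mul_of_nonneg_left ?_ (poissonMass_pos hn' n).le
  have hc : s ^ 3 / 3 * (1 / n ^ 2) ≤ 1 / 3 * (1 / (n : ℝ) ^ 2) := by gcongr
  have : (0 : ℝ) < 1 / n ^ 2 := by positivity
  nlinarith

/-- Going from mean `n` to mean `n + 1` lowers the mass of `{0, …, n}` by
`(1 - 1 / (6 n) + O(n⁻²))` times the mass of `n`. -/
lemma poissonBelow_sub_mem {n : ℕ} (hn : 0 < n) :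
    poissonMass n n * (1 - 1 / (6 * n)) ≤
        poissonBelow n (n + 1) - poissonBelow (n + 1) (n + 1) ∧
      poissonBelow n (n + 1) - poissonBelow (n + 1) (n + 1) ≤
        poissonMass n n * (1 - 1 / (6 * n) + 1 / n ^ 2) := by
  -- Integration over `[0, 1]` is done by monotonicity: `c = 0` makes this function antitone, `c = 1
  -- / n ^ 2` makes it monotone, and the endpoints are compared.
  have hd : ∀ c s : ℝ, HasDerivAt (fun s : ℝ => poissonBelow (n + s) (n + 1)
      + poissonMass n n * (s - s ^ 3 / (6 * n) + c * s))
      (-poissonMass (n + s) n + poissonMass n n * (1 - s ^ 2 / (2 * n) + c)) s := by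
    intro c s
    have h1 : HasDerivAt (fun s : ℝ => poissonBelow (n + s) (n + 1)) (-poissonMass (n + s) n) s := by
      simpa using (hasDerivAt_poissonBelow n (n + s)).comp_const_add (n : ℝ) s
    refine (h1.add ((((hasDerivAt_id s).sub ((hasDerivAt_pow 3 s).div_const (6 * (n : ℝ)))).add
      ((hasDerivAt_id s).const_mul c)).const_mul (poissonMass n n))).congr_deriv ?_
    field_simp
    push_cast
    ring
  constructor
  · have ha : AntitoneOn (fun s : ℝ => poissonBelow (n + s) (n + 1)
        + poissonMass n n * (s - s ^ 3 / (6 * n) + 0 * s)) (Set.Icc 0 1) := by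
      refine antitoneOn_of_deriv_nonpos (convex_Icc 0 1)
        (fun x _ => (hd 0 x).continuousAt.continuousWithinAt)
        (fun x _ => (hd 0 x).differentiableAt.differentiableWithinAt) fun x hx => ?_
      rw [(hd 0 x).deriv]
      have := poissonMass_add_ge hn (interior_subset hx).1
      linarith
    have := ha (Set.left_mem_Icc.2 zero_le_one) (Set.right_mem_Icc.2 zero_le_one) zero_le_one
    simp only [add_zero, one_pow] at this
    norm_num at this ⊢
    linarith
  · have ha : MonotoneOn (fun s : ℝ => poissonBelow (n + s) (n + 1)
        + poissonMass n n * (s - s ^ 3 / (6 * n) + 1 / n ^ 2 * s)) (Set.Icc 0 1) := by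
      refine monotoneOn_of_deriv_nonneg (convex_Icc 0 1)
        (fun x _ => (hd _ x).continuousAt.continuousWithinAt)
        (fun x _ => (hd _ x).differentiableAt.differentiableWithinAt) fun x hx => ?_
      rw [(hd _ x).deriv]
      have := poissonMass_add_le hn (interior_subset hx).1 (interior_subset hx).2
      linarith
    have := ha (Set.left_mem_Icc.2 zero_le_one) (Set.right_mem_Icc.2 zero_le_one) zero_le_one
    simp only [add_zero, one_pow] at this
    norm_num at this ⊢
    linarith

lemma poissonMass_sub_mem {n : ℕ} (hn : 0 < n) :
    poissonMass n n * (1 / (2 * n) - 1 / n ^ 2) ≤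
        poissonMass n n - poissonMass (n + 1) (n + 1) ∧
      poissonMass n n - poissonMass (n + 1) (n + 1) ≤ poissonMass n n * (1 / (2 * n)) := by
  rw [poissonMass_succ_self]
  have h1 := poissonMass_add_ge hn zero_le_one
  have h2 := poissonMass_add_le hn zero_le_one le_rfl
  rw [one_pow] at h1 h2
  constructor <;> linarith

/-! ### Limits for integer mean: Stirling and the central limit theorem -/

lemma tendsto_poissonMass_self : Tendsto (fun n : ℕ => poissonMass n n) atTop (𝓝 0) := by
  have h : ∀ᶠ n : ℕ in atTop, (Real.sqrt (2 * n) * Stirling.stirlingSeq n)⁻¹ = poissonMass n n := by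
    filter_upwards [eventually_gt_atTop 0] with n hn
    have hn' : (0 : ℝ) < n := by exact_mod_cast hn
    unfold Stirling.stirlingSeq poissonMass
    rw [div_pow, ← Real.exp_nat_mul, mul_one, Real.exp_neg]
    field_simp
  refine Tendsto.congr' h (Tendsto.inv_tendsto_atTop ?_)
  refine Tendsto.atTop_mul_pos (Real.sqrt_pos.2 Real.pi_pos) ?_ Stirling.tendsto_stirlingSeq_sqrt_pi
  exact Real.tendsto_sqrt_atTop.comp
    (tendsto_natCast_atTop_atTop.const_mul_atTop zero_lt_two)

lemma poissonMeasure_real_singleton_eq (r : ℝ≥0) (k : ℕ) :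
    (poissonMeasure r).real {k} = poissonMass r k :=
  poissonMeasure_real_singleton r k

lemma poissonMeasure_real_Iio (r : ℝ≥0) (k : ℕ) :
    (poissonMeasure r).real (Set.Iio k) = poissonBelow r k := by
  have h : (Set.Iio k : Set ℕ) = (Finset.range k : Set ℕ) := by ext; simp
  rw [h, ← sum_measureReal_singleton]
  simp_rw [poissonMeasure_real_singleton_eq]
  rfl

lemma gaussianReal_Iio_zero : (gaussianReal 0 1).real (Set.Iio 0) = 1 / 2 := by
  have := nullSingletonClass_gaussianReal (μ := 0) (v := 1) one_ne_zero
  have h1 : (gaussianReal 0 1).real (Set.Iio 0) = (gaussianReal 0 1).real (Set.Ioi 0) := by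
    conv_lhs => rw [← neg_zero, ← gaussianReal_map_neg]
    rw [map_measureReal_apply (by fun_prop) (by measurability)]
    congr 1
    ext; simp
  have h2 := probReal_compl_eq_one_sub (μ := gaussianReal 0 1) (measurableSet_Iio (a := (0 : ℝ)))
  rw [Set.compl_Iio, measureReal_congr (Ioi_ae_eq_Ici (μ := gaussianReal 0 1)).symm] at h2
  linarith

lemma charFun_poissonMeasure_standardized (n : ℕ) (t : ℝ) :
    charFun ((poissonMeasure n).map (fun k : ℕ => (√n)⁻¹ * (k : ℝ) + -√n)) t =
      Complex.exp (n * (Complex.exp (((√n)⁻¹ * t : ℝ) * Complex.I) - 1) - √n * t * Complex.I) := by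
  have h : (fun k : ℕ => (√n)⁻¹ * (k : ℝ) + -√n)
      = (· + -√n) ∘ (fun x : ℝ => (√n)⁻¹ * x) ∘ (Nat.cast : ℕ → ℝ) := rfl
  rw [h, ← Measure.map_map (by fun_prop) (by fun_prop), ← Measure.map_map (by fun_prop) (by fun_prop),
    charFun_map_add_const, charFun_map_mul, charFun_map_cast_poissonMeasure, ← Complex.exp_add]
  congr 1
  simp
  ring

lemma tendsto_charFun_poissonMeasure_standardized (t : ℝ) :
    Tendsto (fun n : ℕ => charFun
      ((poissonMeasure n).map (fun k : ℕ => (√n)⁻¹ * (k : ℝ) + -√n)) t) atTop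
      (𝓝 (charFun (gaussianReal 0 1) t)) := by
  simp_rw [charFun_poissonMeasure_standardized]
  rw [charFun_gaussianReal]
  refine (Complex.continuous_exp.tendsto _).comp ?_
  have hz : Tendsto (fun n : ℕ => (√(n : ℝ))⁻¹) atTop (𝓝 0) :=
    tendsto_inv_atTop_zero.comp (Real.tendsto_sqrt_atTop.comp tendsto_natCast_atTop_atTop)
  have hb : Tendsto (fun n : ℕ => |t| ^ 3 * (√(n : ℝ))⁻¹) atTop (𝓝 0) := by
    simpa using hz.const_mul (|t| ^ 3)
  have hw : ∀ᶠ n : ℕ in atTop, |(√(n : ℝ))⁻¹ * t| < 1 := by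
    have : Tendsto (fun n : ℕ => |(√(n : ℝ))⁻¹ * t|) atTop (𝓝 0) := by
      simpa using (hz.mul_const t).abs
    exact this.eventually_lt_const zero_lt_one
  rw [tendsto_iff_norm_sub_tendsto_zero]
  refine squeeze_zero' (Eventually.of_forall fun _ => norm_nonneg _) ?_ hb
  filter_upwards [hw, eventually_gt_atTop 0] with n hn hn0
  have hn' : (0 : ℝ) < n := by exact_mod_cast hn0
  set w : ℂ := (((√n)⁻¹ * t : ℝ) : ℂ) * Complex.I with hwdef
  have hnorm : ‖w‖ = (√n)⁻¹ * |t| := by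
    rw [hwdef, norm_mul, Complex.norm_I, mul_one, Complex.norm_real, Real.norm_eq_abs, abs_mul,
      abs_of_nonneg (by positivity)]
  have hle : ‖w‖ ≤ 1 := by
    rw [hwdef, norm_mul, Complex.norm_I, mul_one, Complex.norm_real, Real.norm_eq_abs]
    exact hn.le
  have hs : √(n : ℝ) ^ 2 = n := Real.sq_sqrt hn'.le
  have hs0 : √(n : ℝ) ≠ 0 := (Real.sqrt_pos.2 hn').ne'
  have hsc : (√(n : ℝ) : ℂ) ^ 2 = n := by exact_mod_cast congrArg (Complex.ofReal) hs
  have hs0c : (√(n : ℝ) : ℂ) ≠ 0 := by exact_mod_cast hs0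
  have he := Complex.exp_bound hle (n := 3) (by norm_num)
  have key : (n : ℂ) * (Complex.exp w - 1) - √n * t * Complex.I
      - (t * (0 : ℝ) * Complex.I - ((1 : ℝ≥0) : ℝ) * t ^ 2 / 2)
      = n * (Complex.exp w - ∑ m ∈ Finset.range 3, w ^ m / m.factorial) := by
    have h1 : (n : ℂ) * w = √n * t * Complex.I := by
      rw [hwdef, ← hsc]; push_cast; field_simp
    have h2 : (n : ℂ) * w ^ 2 = - t ^ 2 := by
      rw [hwdef, ← hsc, mul_pow, Complex.I_sq]; push_cast; field_simp
    simp only [Finset.sum_range_succ, Finset.sum_range_zero, Nat.factorial]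
    push_cast
    linear_combination h1 + h2 / 2
  rw [key, norm_mul, Complex.norm_natCast]
  -- The Taylor remainder is of order `n * ‖w‖ ^ 3` with `‖w‖ = |t| / √n`; its constant `4 / (3! *
  -- 3)` is relaxed to `1`.
  calc (n : ℝ) * _ ≤ n * (‖w‖ ^ 3 * 1) := by
        gcongr
        refine he.trans ?_
        gcongr
        norm_num [Nat.factorial]
    _ = |t| ^ 3 * (√n)⁻¹ := by
        rw [hnorm, mul_pow, mul_one]
        nth_rw 1 [← hs]
        field_simp

/-- The median of a Poisson law with integer mean `n` is `n` to first order. -/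
lemma tendsto_poissonBelow_self : Tendsto (fun n : ℕ => poissonBelow n n) atTop (𝓝 (1 / 2)) := by
  let μ : ℕ → ProbabilityMeasure ℝ := fun n =>
    ⟨(poissonMeasure n).map (fun k : ℕ => (√n)⁻¹ * (k : ℝ) + -√n),
      Measure.isProbabilityMeasure_map (by fun_prop)⟩
  let μ₀ : ProbabilityMeasure ℝ := ⟨gaussianReal 0 1, inferInstance⟩
  have hμ : Tendsto μ atTop (𝓝 μ₀) :=
    ProbabilityMeasure.tendsto_iff_tendsto_charFun.2 tendsto_charFun_poissonMeasure_standardized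
  have := nullSingletonClass_gaussianReal (μ := 0) (v := 1) one_ne_zero
  -- Portmanteau on `Set.Iio 0`, whose frontier is Gaussian-null; after standardization it
  -- corresponds to `{0, …, n - 1}`.
  have h := ProbabilityMeasure.tendsto_measure_of_null_frontier_of_tendsto' hμ
    (E := Set.Iio 0) (by rw [frontier_Iio]; exact measure_singleton (μ := gaussianReal 0 1) 0)
  have h' := (ENNReal.tendsto_toReal (measure_ne_top (gaussianReal 0 1) (Set.Iio 0))).comp h
  rw [← measureReal_def, gaussianReal_Iio_zero] at h'
  refine h'.congr' ?_
  filter_upwards [eventually_gt_atTop 0] with n hn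
  have hn' : (0 : ℝ) < √n := Real.sqrt_pos.2 (by exact_mod_cast hn)
  change ((poissonMeasure n).map (fun k : ℕ => (√n)⁻¹ * (k : ℝ) + -√n)).real (Set.Iio 0) = _
  rw [map_measureReal_apply (by fun_prop) measurableSet_Iio]
  have hset : (fun k : ℕ => (√n)⁻¹ * (k : ℝ) + -√n) ⁻¹' Set.Iio 0 = Set.Iio n := by
    ext k
    have : (√n)⁻¹ * (k : ℝ) < √n ↔ (k : ℝ) < √n * √n := by
      rw [inv_mul_lt_iff₀ hn']
    rw [Real.mul_self_sqrt (Nat.cast_nonneg n), Nat.cast_lt] at this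
    simp only [Set.mem_preimage, Set.mem_Iio, ← sub_eq_add_neg, sub_neg, this]
  rw [hset, poissonMeasure_real_Iio]
  simp

/-! ### Ramanujan's estimate -/

/-- A discrete l'Hôpital (Stolz–Cesàro) bound: if the increments of a null sequence `b` are
eventually dominated by `c` times those of a null sequence `p`, then `b ≤ c p` eventually. -/
lemma eventually_le_of_sub_succ_le {b p : ℕ → ℝ} {c : ℝ} (hb : Tendsto b atTop (𝓝 0))
    (hp : Tendsto p atTop (𝓝 0))
    (h : ∀ᶠ n in atTop, b n - b (n + 1) ≤ c * (p n - p (n + 1))) :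
    ∀ᶠ n in atTop, b n ≤ c * p n := by
  obtain ⟨n₀, hn₀⟩ := eventually_atTop.1 h
  have hlim : Tendsto (fun n => b n - c * p n) atTop (𝓝 0) := by
    simpa using hb.sub (hp.const_mul c)
  filter_upwards [eventually_ge_atTop n₀] with n hn
  have hmono : Monotone fun m => b (n + m) - c * p (n + m) := by
    refine monotone_nat_of_le_succ fun m => ?_
    have := hn₀ (n + m) (by omega)
    rw [← add_assoc]
    linarith
  have hlim' : Tendsto (fun m => b (n + m) - c * p (n + m)) atTop (𝓝 0) := by
    simpa only [Function.comp_def, add_comm n] using hlim.comp (tendsto_add_atTop_nat n)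
  have := hmono.ge_of_tendsto hlim' 0
  simp only [add_zero] at this
  linarith

/-- The decrement is `p n` minus the drop bounded in `poissonBelow_sub_mem`, so the leading terms
cancel and `1 / (6 * n)` remains. -/
lemma half_sub_poissonBelow_sub_mem {n : ℕ} (hn : 0 < n) :
    poissonMass n n * (1 / (6 * n) - 1 / n ^ 2) ≤
        (1 / 2 - poissonBelow n n) - (1 / 2 - poissonBelow (n + 1) (n + 1)) ∧
      (1 / 2 - poissonBelow n n) - (1 / 2 - poissonBelow (n + 1) (n + 1)) ≤
        poissonMass n n * (1 / (6 * n)) := by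
  have h := poissonBelow_sub_mem hn
  rw [poissonBelow_succ n n] at h
  constructor <;> linarith [h.1, h.2]

/-- Ramanujan's estimate: for integer mean `n`, the mass below `n` falls short of `1 / 2` by
asymptotically one third of the mass of `n`. -/
lemma eventually_abs_half_sub_poissonBelow_le {δ : ℝ} (hδ : 0 < δ) :
    ∀ᶠ n : ℕ in atTop,
      |1 / 2 - poissonBelow n n - 1 / 3 * poissonMass n n| ≤ δ * poissonMass n n := by
  have hb : Tendsto (fun n : ℕ => 1 / 2 - poissonBelow n n) atTop (𝓝 0) := by
    have h := (tendsto_const_nhds (x := (1 / 2 : ℝ))).sub tendsto_poissonBelow_self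
    rwa [sub_self] at h
  -- Beyond this threshold the gain `δ / (2 * n)` absorbs all the `1 / n ^ 2` errors, in both
  -- bounds.
  have hlarge : ∀ᶠ n : ℕ in atTop, 0 < n ∧ 2 * (1 + δ) ≤ δ * n := by
    refine (eventually_gt_atTop 0).and ?_
    exact (tendsto_natCast_atTop_atTop.const_mul_atTop hδ).eventually_ge_atTop _
  have hU : ∀ᶠ n : ℕ in atTop, 1 / 2 - poissonBelow n n ≤ (1 / 3 + δ) * poissonMass n n := by
    refine eventually_le_of_sub_succ_le (b := fun n : ℕ => 1 / 2 - poissonBelow n n)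
      (p := fun n : ℕ => poissonMass n n) hb tendsto_poissonMass_self ?_
    filter_upwards [hlarge] with n ⟨hn, hl⟩
    have hn' : (0 : ℝ) < n := by exact_mod_cast hn
    push_cast
    refine (half_sub_poissonBelow_sub_mem hn).2.trans ?_
    refine le_trans ?_ (mul_le_mul_of_nonneg_left (poissonMass_sub_mem hn).1 (by positivity))
    rw [mul_left_comm]
    refine mul_le_mul_of_nonneg_left ?_ (poissonMass_pos hn' n).le
    rw [← sub_nonneg]
    have : (1 / 3 + δ) * (1 / (2 * n) - 1 / n ^ 2) - 1 / (6 * n)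
      = (δ * n - 2 * (1 / 3 + δ)) / (2 * (n : ℝ) ^ 2) := by field_simp; ring
    rw [this]
    exact div_nonneg (by linarith) (by positivity)
  -- The lower bound is the same comparison for the negated sequence; the constant `c` there may
  -- have any sign.
  have hL : ∀ᶠ n : ℕ in atTop,
      -(1 / 2 - poissonBelow n n) ≤ -(1 / 3 - δ) * poissonMass n n := by
    refine eventually_le_of_sub_succ_le (b := fun n : ℕ => -(1 / 2 - poissonBelow n n))
      (p := fun n : ℕ => poissonMass n n) (by simpa using hb.neg) tendsto_poissonMass_self ?_
    filter_upwards [hlarge] with n ⟨hn, hl⟩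
    have hn' : (0 : ℝ) < n := by exact_mod_cast hn
    have hp := poissonMass_pos hn' n
    have h1 := (half_sub_poissonBelow_sub_mem hn).1
    have h2 := poissonMass_sub_mem hn
    have h3 : 1 / 3 * (poissonMass n n - poissonMass (n + 1) (n + 1))
        ≤ poissonMass n n * (1 / (6 * n)) :=
      (mul_le_mul_of_nonneg_left h2.2 (by norm_num)).trans_eq (by field_simp; norm_num)
    have h4 := mul_le_mul_of_nonneg_left h2.1 hδ.le
    have h5 : 0 ≤ poissonMass n n * (δ * (1 / (2 * n) - 1 / n ^ 2) - 1 / n ^ 2) := by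
      refine mul_nonneg hp.le ?_
      have : δ * (1 / (2 * n) - 1 / n ^ 2) - 1 / n ^ 2
        = (δ * n - 2 * (1 + δ)) / (2 * (n : ℝ) ^ 2) := by field_simp; ring
      rw [this]
      exact div_nonneg (by linarith) (by positivity)
    push_cast
    linarith
  filter_upwards [hU, hL] with n h1 h2
  rw [abs_le]
  constructor <;> linarith

/-! ### Uniform expansion for real means near `n` -/

lemma poissonMass_div_self {n : ℕ} (hn : 0 < n) (d : ℝ) :
    poissonMass (n + d) n
      = poissonMass n n * (Real.exp (-(d / n)) * (1 + d / n)) ^ n := by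
  have hn' : (0 : ℝ) < n := by exact_mod_cast hn
  have hp : ((n : ℝ) + d) ^ n = n ^ n * (1 + d / n) ^ n := by rw [← mul_pow]; congr 1; field_simp
  have he : (n : ℝ) * -(d / n) = -d := by field_simp
  unfold poissonMass
  rw [neg_add, Real.exp_add, hp, mul_pow, ← Real.exp_nat_mul, he]
  field_simp

/-- With `x = d / n`, of either sign, `1 - x ^ 2 ≤ exp (-x) * (1 + x) ≤ 1`; Bernoulli's inequality
turns the `n`-th power of the left side into `1 - 1 / n`. -/
lemma abs_poissonMass_sub_self_le {n : ℕ} (hn : 2 ≤ n) {s : ℝ} (hs : |s - n| ≤ 1) :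
    poissonMass n n * (1 - 1 / n) ≤ poissonMass s n ∧ poissonMass s n ≤ poissonMass n n := by
  have hn' : (2 : ℝ) ≤ n := by exact_mod_cast hn
  have hn0 : (0 : ℝ) < n := by linarith
  have hp := poissonMass_pos hn0 n
  obtain ⟨d, rfl⟩ : ∃ d, s = n + d := ⟨s - n, by ring⟩
  rw [add_sub_cancel_left] at hs
  obtain ⟨hd1, hd2⟩ := abs_le.1 hs
  rw [poissonMass_div_self (by omega)]
  have hdn : |d / n| ≤ 1 := by
    rw [abs_div, abs_of_pos hn0, div_le_one hn0]; linarith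
  obtain ⟨h1, h2⟩ := abs_le.1 hdn
  constructor
  · refine mul_le_mul_of_nonneg_left ?_ hp.le
    have hsq : (d / n) ^ 2 ≤ 1 := by rw [← sq_abs]; exact pow_le_one₀ (abs_nonneg _) hdn
    calc 1 - 1 / (n : ℝ) ≤ 1 + n * -(d / n) ^ 2 := by
          have : (n : ℝ) * (d / n) ^ 2 = d ^ 2 / n := by field_simp
          have hd : d ^ 2 / n ≤ 1 / n := by
            gcongr; rw [← sq_abs]; exact pow_le_one₀ (abs_nonneg _) hs
          linarith
      _ ≤ (1 + -(d / n) ^ 2) ^ n := one_add_mul_le_pow (by linarith) n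
      _ ≤ _ := by
          refine pow_le_pow_left₀ (by linarith) ?_ n
          have := mul_le_mul_of_nonneg_right (Real.add_one_le_exp (-(d / n)))
            (show 0 ≤ 1 + d / n by linarith)
          linarith
  · refine mul_le_of_le_one_right hp.le (pow_le_one₀ ?_ ?_)
    · exact mul_nonneg (Real.exp_pos _).le (by linarith)
    · rw [Real.exp_neg, inv_mul_le_one₀ (Real.exp_pos _)]
      linarith [Real.add_one_le_exp (d / n)]

/-- The shifted index is that of the derivative of `poissonBelow s (n + 1)`. With `x = 1 / (n + 1)`,
the factor `(n + 1) / s` lies between `1 - x` and `1 + 2 * x`; the constant `3` covers `(1 - x) ^ 2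
≥ 1 - 3 * x`. -/
lemma abs_poissonMass_pred_sub_self_le {n : ℕ} (hn : 1 ≤ n) {s : ℝ} (hs : |s - (n + 1 : ℕ)| ≤ 1) :
    |poissonMass s n - poissonMass (n + 1 : ℕ) (n + 1)|
      ≤ 3 / (n + 1 : ℕ) * poissonMass (n + 1 : ℕ) (n + 1) := by
  obtain ⟨h1, h2⟩ := abs_poissonMass_sub_self_le (by omega) hs
  obtain ⟨hs1, hs2⟩ := abs_le.1 hs
  have hn' : (1 : ℝ) ≤ n := by exact_mod_cast hn
  have hp := poissonMass_pos (s := ((n + 1 : ℕ) : ℝ)) (by positivity) (n + 1)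
  push_cast at *
  have hs0 : 0 < s := by linarith
  set p := poissonMass ((n : ℝ) + 1) (n + 1)
  have hr : poissonMass s n = (n + 1) / s * poissonMass s (n + 1) := by
    rw [poissonMass_succ]; field_simp
  have hps := poissonMass_pos hs0 (n + 1)
  rw [hr, abs_le]
  set q := poissonMass s (n + 1)
  have hx : (1 : ℝ) / (n + 1) ≤ 1 / 2 := by
    apply one_div_le_one_div_of_le <;> linarith
  have e3 : (3 : ℝ) / (n + 1) = 3 * (1 / (n + 1)) := by ring
  rw [e3]
  have hlow : 1 - 1 / ((n : ℝ) + 1) ≤ (n + 1) / s := by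
    rw [le_div_iff₀ hs0]
    have : (1 - 1 / ((n : ℝ) + 1)) * s ≤ (1 - 1 / ((n : ℝ) + 1)) * (n + 2) :=
      mul_le_mul_of_nonneg_left (by linarith) (by linarith)
    refine this.trans ?_
    rw [← sub_nonneg]
    have : (n : ℝ) + 1 - (1 - 1 / (n + 1)) * (n + 2) = 1 / (n + 1) := by field_simp; ring
    rw [this]; positivity
  have hupp : (n + 1) / s ≤ 1 + 2 * (1 / ((n : ℝ) + 1)) := by
    rw [div_le_iff₀ hs0]
    have : (1 + 2 * (1 / ((n : ℝ) + 1))) * n ≤ (1 + 2 * (1 / ((n : ℝ) + 1))) * s :=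
      mul_le_mul_of_nonneg_left (by linarith) (by positivity)
    refine le_trans ?_ this
    rw [← sub_nonneg]
    have : (1 + 2 * (1 / ((n : ℝ) + 1))) * n - (n + 1) = (n - 1) / (n + 1) := by field_simp; ring
    rw [this]; exact div_nonneg (by linarith) (by positivity)
  constructor
  · have ha : (1 - 1 / ((n : ℝ) + 1)) * (p * (1 - 1 / (n + 1))) ≤ (n + 1) / s * q :=
      mul_le_mul hlow h1 (mul_nonneg hp.le (by linarith)) (by positivity)
    have : 0 ≤ p * (1 / ((n : ℝ) + 1)) := by positivity
    have : 0 ≤ p * (1 / ((n : ℝ) + 1)) ^ 2 := by positivity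
    linarith
  · have ha : (n + 1) / s * q ≤ (1 + 2 * (1 / ((n : ℝ) + 1))) * p :=
      mul_le_mul hupp h2 hps.le (by positivity)
    have : 0 ≤ p * (1 / ((n : ℝ) + 1)) := by positivity
    linarith

/-- Mean value inequality for `poissonBelow x n + x * p n`, whose derivative is small by the
preceding bound. -/
lemma abs_poissonBelow_sub_self_le {n : ℕ} (hn : 2 ≤ n) {s : ℝ} (hs : |s - n| ≤ 1) :
    |poissonBelow s n - poissonBelow n n - (n - s) * poissonMass n n|
      ≤ 3 / n * poissonMass n n := by
  obtain ⟨m, rfl⟩ : ∃ m, n = m + 1 := ⟨n - 1, by omega⟩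
  set p := poissonMass (m + 1 : ℕ) (m + 1)
  have hd : ∀ x ∈ Set.Icc (((m + 1 : ℕ) : ℝ) - 1) ((m + 1 : ℕ) + 1),
      HasDerivWithinAt (fun x => poissonBelow x (m + 1) + x * p) (-poissonMass x m + p)
        (Set.Icc (((m + 1 : ℕ) : ℝ) - 1) ((m + 1 : ℕ) + 1)) x := fun x _ =>
    ((hasDerivAt_poissonBelow m x).add (by simpa using (hasDerivAt_id x).mul_const p)).hasDerivWithinAt
  have hp : 0 ≤ p := (poissonMass_pos (by positivity) _).le
  have h := (convex_Icc (((m + 1 : ℕ) : ℝ) - 1) ((m + 1 : ℕ) + 1)).norm_image_sub_le_of_norm_hasDerivWithin_le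
    (C := 3 / (m + 1 : ℕ) * p) (x := ((m + 1 : ℕ) : ℝ)) (y := s) hd ?_ ?_ ?_
  · rw [Real.norm_eq_abs, Real.norm_eq_abs] at h
    refine le_trans (le_of_eq ?_) (h.trans (mul_le_of_le_one_right (by positivity) hs))
    congr 1
    ring
  · intro x hx
    rw [Real.norm_eq_abs, neg_add_eq_sub, abs_sub_comm]
    exact abs_poissonMass_pred_sub_self_le (by omega)
      (abs_le.2 ⟨by linarith [hx.1], by linarith [hx.2]⟩)
  · constructor <;> linarith
  · obtain ⟨h1, h2⟩ := abs_le.1 hs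
    constructor <;> linarith

/-- First-order expansion, around the level `1 / 2`, of the linearly interpolated Poisson
distribution function near its mean. -/
lemma eventually_abs_interpolation_sub_le {δ : ℝ} (hδ : 0 < δ) :
    ∀ᶠ n : ℕ in atTop, ∀ s t : ℝ, |s - n| ≤ 1 → 0 ≤ t → t ≤ 1 →
      |poissonBelow s n + t * poissonMass s n - 1 / 2 - (n + t - s - 1 / 3) * poissonMass n n|
        ≤ δ * poissonMass n n := by
  -- Half of `δ` pays for Ramanujan's estimate, the other half for the errors `3 / n` and `1 / n` of
  -- moving the mean from `n` to `s`.
  filter_upwards [eventually_abs_half_sub_poissonBelow_le (half_pos hδ), eventually_ge_atTop 2,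
    (tendsto_natCast_atTop_atTop.const_mul_atTop (half_pos hδ)).eventually_ge_atTop 4]
    with n h1 hn h4 s t hs ht0 ht1
  have hn0 : (0 : ℝ) < n := by exact_mod_cast (by omega : 0 < n)
  have hp := poissonMass_pos hn0 n
  obtain ⟨ha, ha'⟩ := abs_le.1 h1
  obtain ⟨hb, hb'⟩ := abs_le.1 (abs_poissonBelow_sub_self_le hn hs)
  obtain ⟨hc, hc'⟩ := abs_poissonMass_sub_self_le hn hs
  have e : 3 / (n : ℝ) * poissonMass n n + 1 / n * poissonMass n n ≤ δ / 2 * poissonMass n n := by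
    rw [← add_mul, ← add_div]
    refine mul_le_mul_of_nonneg_right ?_ hp.le
    rw [div_le_iff₀ hn0]
    linarith
  have hx : 0 ≤ 1 / n * poissonMass n n := by positivity
  have hm1 : t * (poissonMass n n - poissonMass s n) ≤ 1 / n * poissonMass n n := by
    refine (mul_le_of_le_one_left (by linarith) ht1).trans (by linarith)
  have hm2 : 0 ≤ t * (poissonMass n n - poissonMass s n) := mul_nonneg ht0 (by linarith)
  rw [abs_le]
  constructor <;> linarith

/-- `x + 1 / 3 + ε` lies above, and `x + 1 / 3 - ε` below, the median of the interpolated Poisson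
distribution with large mean `x`. -/
lemma eventually_interpolation_half {ε : ℝ} (hε : 0 < ε) (hε' : ε ≤ 1 / 3) :
    ∀ᶠ s : ℝ in atTop,
      (∃ (k : ℕ) (t : ℝ), 0 ≤ t ∧ t ≤ 1 ∧ k + t = s + 1 / 3 + ε ∧
        1 / 2 < poissonBelow s k + t * poissonMass s k) ∧
      (∃ (k : ℕ) (t : ℝ), 0 ≤ t ∧ t ≤ 1 ∧ k + t = s + 1 / 3 - ε ∧
        poissonBelow s k + t * poissonMass s k < 1 / 2) := by
  obtain ⟨n₀, hn₀⟩ := eventually_atTop.1 (eventually_abs_interpolation_sub_le (half_pos hε))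
  filter_upwards [eventually_ge_atTop ((n₀ : ℝ) + 2)] with s hs
  have hn₀0 : (0 : ℝ) ≤ n₀ := Nat.cast_nonneg _
  -- Since `ε ≤ 1 / 3`, such `x` lies in `[s, s + 2 / 3]`, so its floor is within `1` of `s`.
  have key : ∀ x : ℝ, s + 1 / 3 - ε ≤ x → x ≤ s + 1 / 3 + ε → ∃ (k : ℕ) (t : ℝ),
      0 ≤ t ∧ t ≤ 1 ∧ k + t = x ∧ 0 < poissonMass k k ∧
      |poissonBelow s k + t * poissonMass s k - 1 / 2 - (k + t - s - 1 / 3) * poissonMass k k|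
        ≤ ε / 2 * poissonMass k k := by
    intro x hx1 hx2
    have hx0 : 0 ≤ x := by linarith
    have hf1 := Nat.floor_le hx0
    have hf2 := Nat.lt_floor_add_one x
    have hk : (n₀ : ℝ) < ⌊x⌋₊ := by linarith
    refine ⟨⌊x⌋₊, x - ⌊x⌋₊, by linarith, by linarith, by ring, poissonMass_pos (by linarith) _,
      hn₀ _ (by exact_mod_cast hk.le) s _ (abs_le.2 ⟨by linarith, by linarith⟩) (by linarith)
        (by linarith)⟩
  constructor
  · obtain ⟨k, t, h0, h1, he, hp, ha⟩ := key (s + 1 / 3 + ε) (by linarith) le_rfl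
    refine ⟨k, t, h0, h1, he, ?_⟩
    -- The main term is now `ε * p k` and the error at most half of it.
    rw [he] at ha
    have := (abs_le.1 ha).1
    nlinarith
  · obtain ⟨k, t, h0, h1, he, hp, ha⟩ := key (s + 1 / 3 - ε) le_rfl (by linarith)
    refine ⟨k, t, h0, h1, he, ?_⟩
    rw [he] at ha
    have := (abs_le.1 ha).2
    nlinarith

/-! ### Law of large numbers for sample medians -/

section SampleMedian

variable {Ω : Type*} [MeasurableSpace Ω] {P : Measure Ω} [IsProbabilityMeasure P] {Z : ℕ → Ω → ℝ}

lemma natCard_subtype_eq_sum_indicator (z : ℕ → ℝ) (S : Set ℝ) (n : ℕ) :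
    (Nat.card {i : Fin n // z i ∈ S} : ℝ) = ∑ i ∈ Finset.range n, S.indicator 1 (z i) := by
  classical
  rw [Nat.card_eq_fintype_card, Fintype.card_subtype, Finset.card_filter, Nat.cast_sum,
    ← Fin.sum_univ_eq_sum_range (fun i => S.indicator (1 : ℝ → ℝ) (z i))]
  refine Finset.sum_congr rfl fun i _ => ?_
  by_cases h : z i ∈ S <;> simp [h]

/-- If a set has probability less than `1 / 2`, then asymptotically almost surely fewer than half
of the observations fall into it. -/
lemma tendsto_measure_half_le_card (hindep : Pairwise fun i j => IndepFun (Z i) (Z j) P)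
    (hident : ∀ i, IdentDistrib (Z i) (Z 0) P P) {S : Set ℝ} (hS : MeasurableSet S)
    (hlt : P.real (Z 0 ⁻¹' S) < 1 / 2) :
    Tendsto (fun n : ℕ => P {ω | n ≤ 2 * Nat.card {i : Fin n // Z i ω ∈ S}}) atTop (𝓝 0) := by
  have hf : Measurable (S.indicator (1 : ℝ → ℝ)) := measurable_one.indicator hS
  have hm : ∀ i, AEMeasurable (fun ω => S.indicator (1 : ℝ → ℝ) (Z i ω)) P := fun i =>
    hf.comp_aemeasurable (hident i).aemeasurable_fst
  have hmean : ∫ ω, S.indicator (1 : ℝ → ℝ) (Z 0 ω) ∂P = P.real (Z 0 ⁻¹' S) := by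
    have hZ := (hident 0).aemeasurable_fst
    rw [← integral_map hZ hf.aestronglyMeasurable, integral_indicator_one hS,
      map_measureReal_apply_of_aemeasurable hZ hS]
  have hint : Integrable (fun ω => S.indicator (1 : ℝ → ℝ) (Z 0 ω)) P := by
    refine Integrable.of_bound (hm 0).aestronglyMeasurable 1 (Eventually.of_forall fun ω => ?_)
    by_cases h : Z 0 ω ∈ S <;> simp [h]
  have hslln := strong_law_ae_real (fun i ω => S.indicator (1 : ℝ → ℝ) (Z i ω)) hint
    (fun i j hij => (hindep hij).comp hf hf) fun i => (hident i).comp hf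
  rw [hmean] at hslln
  have hconv := tendstoInMeasure_of_tendsto_ae (fun n => by
    exact ((Finset.aemeasurable_fun_sum _ fun i _ => hm i).div_const _).aestronglyMeasurable) hslln
  rw [tendstoInMeasure_iff_norm] at hconv
  refine tendsto_of_tendsto_of_tendsto_of_le_of_le' tendsto_const_nhds
    (hconv (1 / 2 - P.real (Z 0 ⁻¹' S)) (by linarith)) (Eventually.of_forall fun _ => zero_le) ?_
  filter_upwards [eventually_gt_atTop 0] with n hn
  refine measure_mono fun ω hω => ?_
  have hn' : (0 : ℝ) < n := by exact_mod_cast hn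
  have h1 : (n : ℝ) ≤ 2 * Nat.card {i : Fin n // Z i ω ∈ S} := by exact_mod_cast hω
  rw [natCard_subtype_eq_sum_indicator (fun i => Z i ω)] at h1
  refine le_trans ?_ (Real.le_norm_self _)
  -- A frequency of at least `1 / 2` deviates from its limit by the fixed gap `1 / 2 - P.real (Z 0
  -- ⁻¹' S)`.
  have : 1 / 2 ≤ (∑ i ∈ Finset.range n, S.indicator (1 : ℝ → ℝ) (Z i ω)) / n := by
    rw [le_div_iff₀ hn']
    linarith
  linarith

/-- Sample medians asymptotically lie strictly between `a` and `c` as soon as the distribution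
function is below `1 / 2` at `a` and above `1 / 2` somewhere to the left of `c`. -/
lemma tendsto_measure_sampleMedian (hindep : Pairwise fun i j => IndepFun (Z i) (Z j) P)
    (hident : ∀ i, IdentDistrib (Z i) (Z 0) P P) {M : ℕ → Ω → ℝ}
    (hM : ∀ n, 1 ≤ n → ∀ ω, IsSampleMedian (fun i : Fin n => Z i ω) (M n ω)) {a b c : ℝ}
    (ha : P.real {ω | Z 0 ω ≤ a} < 1 / 2) (hb : 1 / 2 < P.real {ω | Z 0 ω ≤ b}) (hbc : b < c) :
    Tendsto (fun n => P {ω | M n ω ≤ a ∨ c ≤ M n ω}) atTop (𝓝 0) := by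
  have h1 := tendsto_measure_half_le_card hindep hident (measurableSet_Iic (a := a)) ha
  have hb' : P.real (Z 0 ⁻¹' Set.Ioi b) < 1 / 2 := by
    have h : Z 0 ⁻¹' Set.Ioi b = {ω | Z 0 ω ≤ b}ᶜ := by ext; simp
    rw [h, probReal_compl_eq_one_sub₀]
    · linarith
    · exact (hident 0).aemeasurable_fst.nullMeasurableSet_preimage measurableSet_Iic
  have h2 := tendsto_measure_half_le_card hindep hident (measurableSet_Ioi (a := b)) hb'
  have h := h1.add h2
  rw [add_zero] at h
  refine tendsto_of_tendsto_of_tendsto_of_le_of_le' tendsto_const_nhds h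
    (Eventually.of_forall fun _ => zero_le) ?_
  filter_upwards [eventually_ge_atTop 1] with n hn
  -- Only inclusion in events about the observations is used, so `M` need not be measurable.
  refine (measure_mono fun ω hω => ?_).trans (measure_union_le _ _)
  obtain ⟨hl, hr⟩ := hM n hn ω
  rcases hω with hω | hω
  · refine Or.inl (hl.trans (Nat.mul_le_mul_left 2 ?_))
    exact Nat.card_mono (Set.toFinite {i : Fin n | Z i ω ∈ Set.Iic a})
      fun i (hi : Z i ω ≤ M n ω) => hi.trans hω
  · refine Or.inr (hr.trans (Nat.mul_le_mul_left 2 ?_))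
    exact Nat.card_mono (Set.toFinite {i : Fin n | Z i ω ∈ Set.Ioi b})
      fun i (hi : M n ω ≤ Z i ω) => hbc.trans_le (hω.trans hi)

end SampleMedian

/-! ### The law of the jittered variables -/

namespace IsPoissonUniformSample

variable {Ω : Type*} [MeasurableSpace Ω] {P : Measure Ω} {lam : ℝ≥0}
  {N : ℕ → Ω → ℕ} {U : ℕ → Ω → ℝ}

lemma aemeasurable_uniform (h : IsPoissonUniformSample P lam N U) (i : ℕ) : AEMeasurable (U i) P :=
  (h.isUniform i).aemeasurable (by simp) (by simp)

lemma aemeasurable_natCast (h : IsPoissonUniformSample P lam N U) (i : ℕ) :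
    AEMeasurable (fun ω => (N i ω : ℝ)) P :=
  measurable_from_nat.comp_aemeasurable (h.hasLaw_poisson i).aemeasurable

lemma aemeasurable_sumElim (h : IsPoissonUniformSample P lam N U) (j : ℕ ⊕ ℕ) :
    AEMeasurable (Sum.elim (fun i ω => (N i ω : ℝ)) U j) P := by
  cases j with
  | inl i => exact h.aemeasurable_natCast i
  | inr i => exact h.aemeasurable_uniform i

lemma indepFun_natCast_uniform (h : IsPoissonUniformSample P lam N U) (i : ℕ) :
    IndepFun (fun ω => (N i ω : ℝ)) (U i) P :=
  h.indep.indepFun (i := Sum.inl i) (j := Sum.inr i) (by simp)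

lemma pairwise_indepFun_jittered (h : IsPoissonUniformSample P lam N U) :
    Pairwise fun i j => IndepFun (jittered N U i) (jittered N U j) P := by
  intro i j hij
  have := h.indep.indepFun_prodMk_prodMk₀ h.aemeasurable_sumElim
    (Sum.inl i) (Sum.inr i) (Sum.inl j) (Sum.inr j) (by simpa) (by simp) (by simp) (by simpa)
  exact this.comp (φ := fun p : ℝ × ℝ => p.1 + p.2) (ψ := fun p : ℝ × ℝ => p.1 + p.2)
    (by fun_prop) (by fun_prop)

lemma identDistrib_jittered [IsProbabilityMeasure P] (h : IsPoissonUniformSample P lam N U)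
    (i : ℕ) : IdentDistrib (jittered N U i) (jittered N U 0) P P := by
  have hN : IdentDistrib (N i) (N 0) P P :=
    ⟨(h.hasLaw_poisson i).aemeasurable, (h.hasLaw_poisson 0).aemeasurable,
      (h.hasLaw_poisson i).map_eq.trans (h.hasLaw_poisson 0).map_eq.symm⟩
  have hU : IdentDistrib (U i) (U 0) P P :=
    ⟨h.aemeasurable_uniform i, h.aemeasurable_uniform 0,
      (h.isUniform i).trans (h.isUniform 0).symm⟩
  have hN' : IdentDistrib (fun ω => (N i ω : ℝ)) (fun ω => (N 0 ω : ℝ)) P P :=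
    hN.comp (measurable_from_nat (f := fun k : ℕ => (k : ℝ)))
  exact (hN'.prodMk hU (h.indepFun_natCast_uniform i) (h.indepFun_natCast_uniform 0)).comp
    (u := fun p : ℝ × ℝ => p.1 + p.2) (by fun_prop)

lemma ae_uniform_mem (h : IsPoissonUniformSample P lam N U) (i : ℕ) :
    ∀ᵐ ω ∂P, U i ω ∈ Set.Ioo (0 : ℝ) 1 := by
  refine ae_of_ae_map (h.aemeasurable_uniform i) ?_
  rw [h.isUniform i]
  exact ae_cond_mem measurableSet_Ioo

lemma measureReal_uniform_le (h : IsPoissonUniformSample P lam N U) (i : ℕ) {t : ℝ} (h0 : 0 ≤ t)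
    (h1 : t ≤ 1) : P.real (U i ⁻¹' Set.Iic t) = t := by
  rw [measureReal_def, (h.isUniform i).measure_preimage (by simp) (by simp) measurableSet_Iic]
  have hae : (Set.Ioo (0 : ℝ) 1 ∩ Set.Iic t : Set ℝ) =ᵐ[volume] Set.Ioc 0 t := by
    have : (Set.Ioo (0 : ℝ) 1 ∩ Set.Iic t : Set ℝ) =ᵐ[volume] (Set.Ioc (0 : ℝ) 1 ∩ Set.Iic t : Set ℝ) :=
      Ioo_ae_eq_Ioc.inter (ae_eq_refl _)
    rwa [Set.Ioc_inter_Iic, min_eq_right h1] at this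
  rw [measure_congr hae]
  simp [h0]

/-- The distribution function of a jittered Poisson variable interpolates linearly between the
values of the Poisson distribution function. -/
lemma measureReal_jittered_le [IsProbabilityMeasure P] (h : IsPoissonUniformSample P lam N U)
    (i k : ℕ) {t : ℝ} (h0 : 0 ≤ t) (h1 : t ≤ 1) :
    P.real {ω | jittered N U i ω ≤ k + t} = poissonBelow lam k + t * poissonMass lam k := by
  have hN := h.hasLaw_poisson i
  have hNr := h.aemeasurable_natCast i
  -- The equality is only almost sure because `U i` may leave `(0, 1)` on a null set.
  have hae : {ω | jittered N U i ω ≤ k + t} =ᵐ[P]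
      (({ω | N i ω < k} ∪ ((fun ω => (N i ω : ℝ)) ⁻¹' {(k : ℝ)} ∩ U i ⁻¹' Set.Iic t) : Set Ω)) := by
    filter_upwards [h.ae_uniform_mem i] with ω ⟨hu0, hu1⟩
    refine propext ?_
    change (N i ω : ℝ) + U i ω ≤ k + t ↔ N i ω < k ∨ ((N i ω : ℝ) = k ∧ U i ω ≤ t)
    rcases lt_trichotomy (N i ω) k with hlt | heq | hgt
    · have : (N i ω : ℝ) + 1 ≤ k := by exact_mod_cast hlt
      exact ⟨fun _ => Or.inl hlt, fun _ => by linarith⟩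
    · simp [heq]
    · have hk : (k : ℝ) + 1 ≤ N i ω := by exact_mod_cast hgt
      refine ⟨fun hle => by linarith, fun hor => ?_⟩
      rcases hor with hor | ⟨hor, -⟩
      · omega
      · linarith
  have hI : P.real ((fun ω => (N i ω : ℝ)) ⁻¹' {(k : ℝ)} ∩ U i ⁻¹' Set.Iic t)
      = P.real ((fun ω => (N i ω : ℝ)) ⁻¹' {(k : ℝ)}) * P.real (U i ⁻¹' Set.Iic t) := by
    rw [measureReal_def, (h.indepFun_natCast_uniform i).measure_inter_preimage_eq_mul _ _
      (measurableSet_singleton (k : ℝ)) (measurableSet_Iic (a := t)), ENNReal.toReal_mul]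
    rfl
  have hs : P.real ((fun ω => (N i ω : ℝ)) ⁻¹' {(k : ℝ)}) = poissonMass lam k := by
    have : (fun ω => (N i ω : ℝ)) ⁻¹' {(k : ℝ)} = {ω | N i ω = k} := by ext; simp
    rw [this, hN.measureReal_eq (p := fun m => m = k) (by measurability),
      ← poissonMeasure_real_singleton_eq]
    rfl
  have hlt : P.real {ω | N i ω < k} = poissonBelow lam k := by
    rw [hN.measureReal_eq (p := fun m => m < k) (by measurability), ← poissonMeasure_real_Iio]
    rfl
  rw [measureReal_congr hae, measureReal_union₀, hI, hs, hlt, h.measureReal_uniform_le i h0 h1,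
    mul_comm]
  · exact (hNr.nullMeasurableSet_preimage (measurableSet_singleton _)).inter
      ((h.aemeasurable_uniform i).nullMeasurableSet_preimage measurableSet_Iic)
  · refine (Set.disjoint_left.2 fun ω hω hω' => ?_).aedisjoint
    have : N i ω = k := Nat.cast_injective (R := ℝ) hω'.1
    exact hω.ne this

end IsPoissonUniformSample

/-! ### The population median and the iterated limit -/

/-- The distribution function of a jittered Poisson variable crosses the level `1 / 2` strictly at
its median. -/
lemma IsPoissonUniformSample.rvMedian_jittered_spec {Ω : Type*} [MeasurableSpace Ω]
    {P : Measure Ω} [IsProbabilityMeasure P] {lam : ℝ≥0} {N : ℕ → Ω → ℕ} {U : ℕ → Ω → ℝ}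
    (h : IsPoissonUniformSample P lam N U) (hlam : 0 < lam) (i : ℕ) {ε : ℝ} (hε : 0 < ε) :
    P.real {ω | jittered N U i ω ≤ rvMedian P (jittered N U i) - ε} < 1 / 2 ∧
      ∃ b < rvMedian P (jittered N U i) + ε, 1 / 2 < P.real {ω | jittered N U i ω ≤ b} := by
  set S : Set ℝ := {x : ℝ | 1 / 2 ≤ P.real {ω | jittered N U i ω ≤ x}} with hS
  change P.real {ω | jittered N U i ω ≤ sInf S - ε} < 1 / 2 ∧
    ∃ b < sInf S + ε, 1 / 2 < P.real {ω | jittered N U i ω ≤ b}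
  have hpos : ∀ x ∈ S, 0 ≤ x := by
    intro x hx
    by_contra! hneg
    have hzero := h.measureReal_jittered_le i 0 le_rfl zero_le_one
    have hmono : P.real {ω | jittered N U i ω ≤ x}
        ≤ P.real {ω | jittered N U i ω ≤ ((0 : ℕ) : ℝ) + 0} :=
      measureReal_mono fun ω (hω : _ ≤ x) => hω.trans (by simpa using hneg.le)
    rw [hzero] at hmono
    simp only [poissonBelow, Finset.range_zero, Finset.sum_empty] at hmono
    have : 1 / 2 ≤ P.real {ω | jittered N U i ω ≤ x} := hx
    linarith
  have hne : S.Nonempty := by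
    have hlim : Tendsto (fun k => poissonBelow lam k) atTop (𝓝 1) :=
      (hasSum_one_poissonMeasure lam).tendsto_sum_nat
    obtain ⟨k, hk⟩ := (hlim.eventually_const_le (u := 1 / 2) (by norm_num)).exists
    refine ⟨k + 0, ?_⟩
    change 1 / 2 ≤ P.real {ω | jittered N U i ω ≤ k + 0}
    rw [h.measureReal_jittered_le i k le_rfl zero_le_one]
    linarith
  have hnot : sInf S - ε ∉ S := notMem_of_lt_csInf (sub_lt_self _ hε) ⟨0, hpos⟩
  refine ⟨not_le.1 hnot, ?_⟩
  obtain ⟨x, hxS, hx⟩ := exists_lt_of_csInf_lt hne (lt_add_of_pos_right (sInf S) (half_pos hε))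
  have hf1 := Nat.floor_le (hpos x hxS)
  have hf2 := Nat.lt_floor_add_one x
  set k := ⌊x⌋₊
  set t := x - k
  -- The cap at `1` keeps `k + t'` in the unit cell of `x`, where the distribution function has
  -- positive slope `poissonMass lam k`; hence it exceeds `1 / 2` strictly.
  set t' := min 1 (t + ε / 2)
  have ht : t < t' := lt_min (by linarith) (by linarith)
  refine ⟨k + t', by linarith [min_le_right 1 (t + ε / 2)], ?_⟩
  have hx' : 1 / 2 ≤ P.real {ω | jittered N U i ω ≤ k + t} := by
    rw [add_sub_cancel]; exact hxS
  rw [h.measureReal_jittered_le i k (by linarith) (by linarith)] at hx'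
  rw [h.measureReal_jittered_le i k (by linarith) (min_le_left _ _)]
  have := mul_lt_mul_of_pos_right ht (poissonMass_pos (s := lam) (by exact_mod_cast hlam) k)
  linarith

/-- The iterated limit `n → ∞` and then `lam → ∞`, in probability: for each fixed `lam > 0` the
sample median minus `1/3` converges in probability as `n → ∞` (to the median of `Z 0` minus `1/3`),
and for every `ε > 0` and all sufficiently large `lam`, the probability that the sample median minus
`1/3` is at distance at least `ε` from `lam` tends to `0` as `n → ∞`. -/
theorem mainTheorem8
    (Ω : ℝ≥0 → Type*) [∀ lam, MeasurableSpace (Ω lam)]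
    (P : ∀ lam, Measure (Ω lam)) [∀ lam, IsProbabilityMeasure (P lam)]
    (N : ∀ lam, ℕ → Ω lam → ℕ) (U : ∀ lam, ℕ → Ω lam → ℝ)
    (hNU : ∀ lam, 0 < lam → IsPoissonUniformSample (P lam) lam (N lam) (U lam))
    (M : ∀ lam, ℕ → Ω lam → ℝ)
    (hM : ∀ lam, 0 < lam → ∀ n, 1 ≤ n → ∀ ω,
      IsSampleMedian (fun i : Fin n => jittered (N lam) (U lam) i ω) (M lam n ω)) :
    (∀ lam, 0 < lam →
      TendstoInMeasure (P lam) (fun n ω => M lam n ω - 1 / 3) atTop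
        (fun _ => rvMedian (P lam) (jittered (N lam) (U lam) 0) - 1 / 3)) ∧
    (∀ ε : ℝ, 0 < ε → ∀ᶠ lam : ℝ≥0 in atTop,
      Tendsto (fun n => P lam {ω | ε ≤ |M lam n ω - 1 / 3 - (lam : ℝ)|}) atTop (𝓝 0)) := by
  refine ⟨fun lam hlam => ?_, fun ε hε => ?_⟩
  · rw [tendstoInMeasure_iff_norm]
    intro ε hε
    have h := hNU lam hlam
    obtain ⟨ha, b, hbc, hb⟩ := h.rvMedian_jittered_spec hlam 0 hε
    refine tendsto_of_tendsto_of_tendsto_of_le_of_le tendsto_const_nhds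
      (tendsto_measure_sampleMedian h.pairwise_indepFun_jittered h.identDistrib_jittered
        (hM lam hlam) ha hb hbc) (fun _ => zero_le) fun n => measure_mono fun ω hω => ?_
    have hω' : ε ≤ |M lam n ω - 1 / 3 - (rvMedian (P lam) (jittered (N lam) (U lam) 0) - 1 / 3)| :=
      hω
    rcases le_abs.1 hω' with hle | hle
    · exact Or.inr (by linarith)
    · exact Or.inl (by linarith)
  -- The bound `1 / 3` is required by the expansion; `ε / 2` leaves the strict gap between `b` and
  -- `c = lam + 1 / 3 + ε`.
  · have hδ : 0 < min (ε / 2) (1 / 3) := lt_min (by linarith) (by norm_num)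
    have hδε : min (ε / 2) (1 / 3) < ε := (min_le_left _ _).trans_lt (by linarith)
    have hev := (NNReal.tendsto_coe_atTop.2 tendsto_id).eventually
      (eventually_interpolation_half hδ (min_le_right _ _))
    filter_upwards [hev, eventually_gt_atTop 0] with lam hlam' hlam
    simp only [id] at hlam'
    obtain ⟨⟨k, t, h0, h1, he, hb⟩, k', t', h0', h1', he', ha⟩ := hlam'
    have h := hNU lam hlam
    rw [← h.measureReal_jittered_le 0 k h0 h1, he] at hb
    rw [← h.measureReal_jittered_le 0 k' h0' h1', he'] at ha
    refine tendsto_of_tendsto_of_tendsto_of_le_of_le tendsto_const_nhds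
      (tendsto_measure_sampleMedian h.pairwise_indepFun_jittered h.identDistrib_jittered
        (hM lam hlam) ha hb (add_lt_add_right hδε _)) (fun _ => zero_le)
      fun n => measure_mono fun ω hω => ?_
    have hω' : ε ≤ |M lam n ω - 1 / 3 - (lam : ℝ)| := hω
    rcases le_abs.1 hω' with hle | hle
    · exact Or.inr (by linarith)
    · exact Or.inl (by linarith)
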